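/- Let $H$ be a complex Hilbert space and let $A$ be a nonzero positive semidefinite bounded operator on $H$, with positive square root $A^{1/2}$. Write $\|x\|_A=\langle Ax,x\rangle^{1/2}$ for $x\in H$, and for bounded $T$ put $\|T\|_A=\sup\{\|Tx\|_A/\|x\|_A : x\in\overline{R(A)},\ x\neq 0\}$, where $R(\cdot)$ denotes the range. Let $B_{A^{1/2}}(H)$ be the set of bounded operators $T$ on $H$ with $R(T^*A^{1/2})\subseteq R(A^{1/2})$. For $T\in B_{A^{1/2}}(H)$ let $T^\diamond\in B_{A^{1/2}}(H)$ be the unique bounded operator with $T^*A^{1/2}=A^{1/2}T^\diamond$ and $R(T^\diamond)\subseteq\overline{R(A^{1/2})}$, and let $r_A(T)=\lim_{n\to\infty}\|T^n\|_A^{1/n}$. A nonzero $T\in B_{A^{1/2}}(H)$ is called $A$-invertible in $B_{A^{1/2}}(H)$ if there is a nonzero $S\in B_{A^{1/2}}(H)$ with $ATS=AST=A$. Let $\sigma_A(T)$ be the set of all $\lambda\in\mathbb C$ such that $\lambda-T$ is not $A$-invertible in $B_{A^{1/2}}(H)$. Let $T\in B_{A^{1/2}}(H)$. Then the limits defining $r_A(T)$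 and $r_A(T^\diamond)$ exist, the set $\{|\lambda| : \lambda\in\sigma_A(T)\}$ is nonempty and bounded, and $$\text{either}\quad \sup\{|\lambda| : \lambda\in\sigma_A(T)\}=r_A(T)\quad\text{or}\quad \sup\{|\lambda| : \lambda\in\sigma_A(T)\}=r_A(T^\diamond).$$ More precisely, the first equality holds if $r_A(T)\ge r_A(T^\diamond)$, and the second holds if $r_A(T^\diamond)\ge r_A(T)$. -/

import Mathlib

open scoped InnerProductSpace Topology

namespace SemiHilbert

variable {H : Type*} [NormedAddCommGroup H] [InnerProductSpace ℂ H] [CompleteSpace H]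

/-- The positive square root `A^{1/2}` of a positive semidefinite operator `A`. -/
noncomputable def sqrtOp (A : H →L[ℂ] H) : H →L[ℂ] H := CFC.sqrt A

/-- The seminorm `‖x‖_A = ⟨A x, x⟩^{1/2}`. -/
noncomputable def aSeminorm (A : H →L[ℂ] H) (x : H) : ℝ := √(RCLike.re ⟪A x, x⟫_ℂ)

/-- `‖T‖_A`, the supremum of `‖T x‖_A / ‖x‖_A` over the nonzero `x` in the closure of `R(A)`. -/
noncomputable def aOpNorm (A T : H →L[ℂ] H) : ℝ :=
  sSup {c : ℝ | ∃ x ∈ closure (Set.range A), x ≠ 0 ∧ c = aSeminorm A (T x) / aSeminorm A x}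

/-- The class `B_{A^{1/2}}(H)` of bounded operators `T` with `R(T* A^{1/2}) ⊆ R(A^{1/2})`. -/
def BAHalf (A : H →L[ℂ] H) : Set (H →L[ℂ] H) :=
  {T | Set.range (ContinuousLinearMap.adjoint T ∘L sqrtOp A) ⊆ Set.range (sqrtOp A)}

/-- `D` is the reduced solution of `T* A^{1/2} = A^{1/2} D`. -/
def IsDiamond (A T D : H →L[ℂ] H) : Prop :=
  ContinuousLinearMap.adjoint T ∘L sqrtOp A = sqrtOp A ∘L D ∧
    Set.range D ⊆ closure (Set.range (sqrtOp A))

theorem adjoint_sqrtOp (A : H →L[ℂ] H) :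
    ContinuousLinearMap.adjoint (sqrtOp A) = sqrtOp A := by
  have h : IsSelfAdjoint (CFC.sqrt A) := (CFC.sqrt_nonneg A).isSelfAdjoint
  exact h.adjoint_eq

theorem sqrtOp_comp_sqrtOp (A : H →L[ℂ] H) (hA : A.IsPositive) : sqrtOp A ∘L sqrtOp A = A :=
  CFC.sqrt_mul_sqrt_self A ((ContinuousLinearMap.nonneg_iff_isPositive A).2 hA)

theorem closure_range_sqrtOp (A : H →L[ℂ] H) :
    closure (Set.range (sqrtOp A)) = ((sqrtOp A).kerᗮ : Submodule ℂ H) := by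
  rw [ContinuousLinearMap.orthogonal_ker, adjoint_sqrtOp]
  rfl

theorem sqrtOp_inj (A : H →L[ℂ] H) {y z : H} (hy : y ∈ (sqrtOp A).kerᗮ)
    (hz : z ∈ (sqrtOp A).kerᗮ) (h : sqrtOp A y = sqrtOp A z) : y = z := by
  have h1 : y - z ∈ (sqrtOp A).kerᗮ := Submodule.sub_mem _ hy hz
  have h2 : y - z ∈ (sqrtOp A).ker := by
    rw [LinearMap.mem_ker]
    simp [h]
  have h3 := (Submodule.mem_orthogonal _ _).1 h1 _ h2
  exact sub_eq_zero.1 (inner_self_eq_zero.1 h3)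

/-- Existence and uniqueness of the reduced solution. -/
theorem existsUnique_isDiamond (A T : H →L[ℂ] H) (hT : T ∈ BAHalf A) :
    ∃! D : H →L[ℂ] H, IsDiamond A T D := by
  set S := sqrtOp A with hS
  set F := ContinuousLinearMap.adjoint T ∘L S with hF
  have hclosed : IsClosed ((S.ker : Submodule ℂ H) : Set H) := S.isClosed_ker
  have : CompleteSpace S.ker := hclosed.completeSpace_coe
  have ex : ∀ x : H, ∃ y ∈ S.kerᗮ, S y = F x := by
    intro x
    obtain ⟨y, hy⟩ := hT ⟨x, rfl⟩
    refine ⟨y - S.ker.starProjection y, S.ker.sub_starProjection_mem_orthogonal y, ?_⟩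
    have : S.ker.starProjection y ∈ S.ker := Submodule.starProjection_apply_mem _ _
    rw [LinearMap.mem_ker] at this
    have h' : S (S.ker.starProjection y) = 0 := this
    rw [map_sub, h', sub_zero]
    exact hy
  choose g hg1 hg2 using ex
  let D0 : H →ₗ[ℂ] H :=
    { toFun := g
      map_add' := fun x y => sqrtOp_inj A (hg1 _) (Submodule.add_mem _ (hg1 _) (hg1 _)) (by
        rw [← hS, map_add, hg2, hg2, hg2, map_add])
      map_smul' := fun c x => sqrtOp_inj A (hg1 _) (Submodule.smul_mem _ _ (hg1 _)) (by
        rw [← hS, map_smul, hg2, hg2, map_smul]; rfl) }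
  have hD0 : ∀ x, D0 x = g x := fun _ => rfl
  let D : H →L[ℂ] H := ContinuousLinearMap.ofSeqClosedGraph (g := D0) (by
    intro u x y hu hv
    refine sqrtOp_inj A ?_ (hg1 x) ?_
    · refine (Submodule.isClosed_orthogonal S.ker).mem_of_tendsto hv ?_
      exact Filter.Eventually.of_forall fun n => hg1 (u n)
    · have h1 : Filter.Tendsto (fun n => S (g (u n))) Filter.atTop (𝓝 (S y)) :=
        (S.continuous.tendsto y).comp hv
      simp only [hg2] at h1
      have h2 : Filter.Tendsto (fun n => F (u n)) Filter.atTop (𝓝 (F x)) :=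
        (F.continuous.tendsto x).comp hu
      change S y = S (g x)
      rw [hg2]
      exact tendsto_nhds_unique h1 h2)
  have hD : ∀ x, D x = g x := fun x => rfl
  refine ⟨D, ⟨?_, ?_⟩, ?_⟩
  · ext x
    exact (hg2 x).symm
  · rw [closure_range_sqrtOp]
    rintro _ ⟨x, rfl⟩
    exact hg1 x
  · rintro D' ⟨h1, h2⟩
    ext x
    rw [closure_range_sqrtOp] at h2
    refine sqrtOp_inj A (h2 ⟨x, rfl⟩) (hg1 x) ?_
    rw [← hS, hD, hg2]
    exact (DFunLike.congr_fun h1 x).symm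

/-- `T^◇`, the reduced solution of `T* A^{1/2} = A^{1/2} X`, for `T ∈ B_{A^{1/2}}(H)`. -/
noncomputable def diamond (A T : H →L[ℂ] H) (hT : T ∈ BAHalf A) : H →L[ℂ] H :=
  Classical.choose (existsUnique_isDiamond A T hT).exists

theorem diamond_spec (A T : H →L[ℂ] H) (hT : T ∈ BAHalf A) : IsDiamond A T (diamond A T hT) :=
  Classical.choose_spec (existsUnique_isDiamond A T hT).exists

theorem diamond_mem (A T : H →L[ℂ] H) (hT : T ∈ BAHalf A) : diamond A T hT ∈ BAHalf A := by
  have h := congrArg ContinuousLinearMap.adjoint (diamond_spec A T hT).1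
  rw [ContinuousLinearMap.adjoint_comp, ContinuousLinearMap.adjoint_comp, adjoint_sqrtOp,
    ContinuousLinearMap.adjoint_adjoint] at h
  change Set.range _ ⊆ _
  rw [← h]
  rintro _ ⟨x, rfl⟩
  exact ⟨T x, rfl⟩

/-- `T` is `A`-invertible in `B_{A^{1/2}}(H)`. -/
def IsAInvertible (A T : H →L[ℂ] H) : Prop :=
  T ∈ BAHalf A ∧ T ≠ 0 ∧
    ∃ S : H →L[ℂ] H, S ∈ BAHalf A ∧ S ≠ 0 ∧ A ∘L T ∘L S = A ∧ A ∘L S ∘L T = A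

/-- The `A`-resolvent set `ρ_A(T)`. -/
def aResolventSet (A T : H →L[ℂ] H) : Set ℂ :=
  {z | IsAInvertible A (z • ContinuousLinearMap.id ℂ H - T)}

/-- The `A`-spectrum `σ_A(T)`. -/
def aSpectrum (A T : H →L[ℂ] H) : Set ℂ := (aResolventSet A T)ᶜ

/-- The `A`-spectral radius `r_A(T) = lim ‖T^n‖_A^{1/n}`. -/
noncomputable def aSpectralRadius (A T : H →L[ℂ] H) : ℝ :=
  Filter.limUnder Filter.atTop (fun n : ℕ => aOpNorm A (T ^ n) ^ (1 / (n : ℝ)))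

end SemiHilbert

namespace SemiHilbert

variable {H : Type*} [NormedAddCommGroup H] [InnerProductSpace ℂ H] [CompleteSpace H]

/-! Let K be the closure of R(A^{1/2}), the orthogonal complement of ker A^{1/2}. An operator T lies
in B_{A^{1/2}}(H) exactly when A^{1/2} T = U A^{1/2} for some bounded U on K. Since ‖x‖_A = ‖A^{1/2}
x‖ and A^{1/2} has dense range in K, ‖T^n‖_A = ‖U^n‖, and Gelfand's formula gives r_A(T) = r(U). T
also has a compression C to K. It is A-invertible iff both U and C are invertible
(`isAInvertible_iff`): C⁻¹ supplies a bounded A-inverse on H, and U⁻¹ puts that inverse in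
B_{A^{1/2}}(H). Hence σ_A(T) = σ(U) ∪ σ(C). The lift of T^◇ is C*, so r_A(T^◇) = r(C*) = r(C), and
the largest modulus in σ_A(T) is the maximum of the two radii. -/

theorem spectralRadius_ne_top {B : Type*} [NormedRing B] [NormedAlgebra ℂ B] [CompleteSpace B]
    [NormOneClass B] (b : B) : spectralRadius ℂ b ≠ ⊤ :=
  ((spectrum.spectralRadius_le_nnnorm b).trans_lt ENNReal.coe_lt_top).ne

theorem tendsto_norm_pow_toReal_spectralRadius {B : Type*} [NormedRing B] [NormedAlgebra ℂ B]
    [CompleteSpace B] [NormOneClass B] (b : B) :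
    Filter.Tendsto (fun n : ℕ => ‖b ^ n‖ ^ (1 / (n : ℝ))) Filter.atTop
      (𝓝 (spectralRadius ℂ b).toReal) := by
  refine ((ENNReal.tendsto_toReal (spectralRadius_ne_top b)).comp
    (spectrum.pow_norm_pow_one_div_tendsto_nhds_spectralRadius b)).congr fun n => ?_
  rw [Function.comp_apply, ENNReal.toReal_ofReal (by positivity)]

theorem isGreatest_norm_spectrum {B : Type*} [NormedRing B] [NormedAlgebra ℂ B] [CompleteSpace B]
    [NormOneClass B] [Nontrivial B] (b : B) :
    IsGreatest ((fun z : ℂ => ‖z‖) '' spectrum ℂ b) (spectralRadius ℂ b).toReal := by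
  constructor
  · obtain ⟨z, hz, h⟩ := spectrum.exists_nnnorm_eq_spectralRadius b
    exact ⟨z, hz, by rw [← h]; rfl⟩
  · rintro _ ⟨z, hz, rfl⟩
    have h : (‖z‖₊ : ENNReal) ≤ spectralRadius ℂ b := le_iSup₂ (f := fun (k : ℂ) (_ : k ∈ _) =>
      (‖k‖₊ : ENNReal)) z hz
    exact ENNReal.toReal_mono (spectralRadius_ne_top b) h

theorem norm_image_spectrum_star {B : Type*} [Ring B] [StarRing B] [Algebra ℂ B] [StarModule ℂ B]
    (b : B) : (fun z : ℂ => ‖z‖) '' spectrum ℂ (star b) = (fun z : ℂ => ‖z‖) '' spectrum ℂ b := by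
  rw [spectrum.map_star, ← Set.image_star, Set.image_image]
  simp only [norm_star]

/-- The orthogonal complement of `ker A^{1/2}`, that is, the closure of `R(A^{1/2})`. -/
noncomputable abbrev supp (A : H →L[ℂ] H) : Submodule ℂ H := (sqrtOp A).kerᗮ

theorem sqrtOp_mem_supp (A : H →L[ℂ] H) (x : H) : sqrtOp A x ∈ supp A := by
  have h : sqrtOp A x ∈ closure (Set.range (sqrtOp A)) := subset_closure ⟨x, rfl⟩
  rwa [closure_range_sqrtOp] at h

/-- `A^{1/2}` as an operator into the closure of its range. -/
noncomputable def sqrtTo (A : H →L[ℂ] H) : H →L[ℂ] supp A :=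
  (sqrtOp A).codRestrict (supp A) (sqrtOp_mem_supp A)

@[simp]
theorem coe_sqrtTo (A : H →L[ℂ] H) (x : H) : (sqrtTo A x : H) = sqrtOp A x := rfl

theorem denseRange_sqrtTo (A : H →L[ℂ] H) : DenseRange (sqrtTo A) := by
  intro y
  rw [closure_subtype, ← Set.range_comp]
  change (y : H) ∈ closure (Set.range (sqrtOp A))
  rw [closure_range_sqrtOp]
  exact y.2

/-- The orthogonal projection onto `supp A`. -/
noncomputable abbrev suppProj (A : H →L[ℂ] H) : H →L[ℂ] supp A :=
  (supp A).orthogonalProjectionOnto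

theorem suppProj_coe (A : H →L[ℂ] H) (x : supp A) : suppProj A x = x :=
  Submodule.orthogonalProjectionOnto_mem_subspace_eq_self x

theorem sqrtOp_suppProj (A : H →L[ℂ] H) (x : H) : sqrtOp A (suppProj A x) = sqrtOp A x := by
  have hclosed : IsClosed ((sqrtOp A).ker : Set H) := (sqrtOp A).isClosed_ker
  have : CompleteSpace (sqrtOp A).ker := hclosed.completeSpace_coe
  have h : x - suppProj A x ∈ (supp A)ᗮ := (supp A).sub_starProjection_mem_orthogonal x
  rw [Submodule.orthogonal_orthogonal, LinearMap.mem_ker] at h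
  have h' : sqrtOp A (x - suppProj A x) = 0 := h
  rw [map_sub, sub_eq_zero] at h'
  exact h'.symm

theorem sqrtTo_suppProj (A : H →L[ℂ] H) (x : H) : sqrtTo A (suppProj A x) = sqrtTo A x :=
  Subtype.ext (sqrtOp_suppProj A x)

theorem suppProj_eq_of_sqrtOp_eq (A : H →L[ℂ] H) {x y : H} (h : sqrtOp A x = sqrtOp A y) :
    suppProj A x = suppProj A y :=
  Subtype.ext <| sqrtOp_inj A (suppProj A x).2 (suppProj A y).2 <| by
    rw [sqrtOp_suppProj, sqrtOp_suppProj, h]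

/-- The compression of an operator to `supp A`. -/
noncomputable def compress (A X : H →L[ℂ] H) : supp A →L[ℂ] supp A :=
  suppProj A ∘L X ∘L (supp A).subtypeL

theorem compress_apply (A X : H →L[ℂ] H) (x : supp A) :
    compress A X x = suppProj A (X x) := rfl

theorem star_compress (A X : H →L[ℂ] H) :
    star (compress A X) = compress A (ContinuousLinearMap.adjoint X) := by
  rw [ContinuousLinearMap.star_eq_adjoint, compress, ContinuousLinearMap.adjoint_comp,
    ContinuousLinearMap.adjoint_comp, Submodule.adjoint_subtypeL,
    Submodule.adjoint_orthogonalProjectionOnto]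
  rfl

theorem compress_smul_id_sub (A X : H →L[ℂ] H) (z : ℂ) :
    compress A (z • ContinuousLinearMap.id ℂ H - X) =
      algebraMap ℂ (supp A →L[ℂ] supp A) z - compress A X := by
  ext1 x
  have h : algebraMap ℂ (supp A →L[ℂ] supp A) z x = z • x := by
    simp [Algebra.algebraMap_eq_smul_one]
  rw [sub_apply, h, compress_apply, compress_apply,
    sub_apply, map_sub, smul_apply, map_smul,
    ContinuousLinearMap.id_apply, suppProj_coe]

/-- `U` is the operator on the closure of `R(A^{1/2})` with `A^{1/2} X = U A^{1/2}`. -/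
def IsLift (A X : H →L[ℂ] H) (U : supp A →L[ℂ] supp A) : Prop :=
  ∀ x, sqrtTo A (X x) = U (sqrtTo A x)

/-! ### Algebra of lifts -/

namespace IsLift

variable {A X : H →L[ℂ] H} {U : supp A →L[ℂ] supp A}

theorem pow (h : IsLift A X U) (n : ℕ) : IsLift A (X ^ n) (U ^ n) := by
  induction n with
  | zero => exact fun x => rfl
  | succ n ih =>
    intro x
    rw [pow_succ', pow_succ', mul_apply_eq_comp, h, ih,
      mul_apply_eq_comp]

theorem smul_id_sub (h : IsLift A X U) (z : ℂ) :
    IsLift A (z • ContinuousLinearMap.id ℂ H - X) (algebraMap ℂ _ z - U) := by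
  intro x
  have hz : algebraMap ℂ (supp A →L[ℂ] supp A) z (sqrtTo A x) = z • sqrtTo A x := by
    simp [Algebra.algebraMap_eq_smul_one]
  rw [sub_apply, sub_apply, hz, map_sub, h]
  simp

/-- Extend U by zero to H and take adjoints in A^{1/2} X = U A^{1/2}: then X* A^{1/2} factors
through A^{1/2} on the left. -/
theorem mem_BAHalf (h : IsLift A X U) : X ∈ BAHalf A := by
  have e : sqrtOp A ∘L X = ((supp A).subtypeL ∘L U ∘L suppProj A) ∘L sqrtOp A := by
    ext x
    have h1 := congrArg Subtype.val (h x)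
    have h2 : suppProj A (sqrtOp A x) = sqrtTo A x := suppProj_coe A (sqrtTo A x)
    simpa [h2] using h1
  have e' := congrArg ContinuousLinearMap.adjoint e
  rw [ContinuousLinearMap.adjoint_comp, ContinuousLinearMap.adjoint_comp _ (sqrtOp A),
    adjoint_sqrtOp] at e'
  change Set.range _ ⊆ _
  rw [e']
  rintro _ ⟨x, rfl⟩
  exact ⟨_, rfl⟩

/-- A lift forces X to preserve ker A^{1/2}, so the compression is the map that X induces on H / ker
A^{1/2}. -/
theorem suppProj_apply (h : IsLift A X U) (x : H) :
    suppProj A (X x) = compress A X (suppProj A x) := by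
  have e : sqrtTo A (X x) = sqrtTo A (X (suppProj A x)) := by rw [h, h, sqrtTo_suppProj]
  exact suppProj_eq_of_sqrtOp_eq A (congrArg Subtype.val e)

theorem sqrtTo_compress (h : IsLift A X U) (x : supp A) :
    sqrtTo A (compress A X x) = U (sqrtTo A x) := by
  rw [compress_apply, sqrtTo_suppProj, h]

end IsLift

/-- The adjoint of the reduced solution lifts `T`. -/
theorem isLift_of_isDiamond {A T D : H →L[ℂ] H} (h : IsDiamond A T D) :
    IsLift A T (compress A (ContinuousLinearMap.adjoint D)) := by
  have e := congrArg ContinuousLinearMap.adjoint h.1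
  rw [ContinuousLinearMap.adjoint_comp, ContinuousLinearMap.adjoint_comp, adjoint_sqrtOp,
    ContinuousLinearMap.adjoint_adjoint] at e
  intro x
  have ex : sqrtOp A (T x) = ContinuousLinearMap.adjoint D (sqrtOp A x) := DFunLike.congr_fun e x
  rw [compress_apply, coe_sqrtTo, ← ex]
  exact (suppProj_coe A (sqrtTo A (T x))).symm

/-- The adjoint of the compression of `T` lifts the reduced solution. -/
theorem isLift_diamond {A T D : H →L[ℂ] H} (h : IsDiamond A T D) :
    IsLift A D (star (compress A T)) := by
  intro x
  have ex : ContinuousLinearMap.adjoint T (sqrtOp A x) = sqrtOp A (D x) :=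
    DFunLike.congr_fun h.1 x
  rw [star_compress, compress_apply, coe_sqrtTo, ex]
  exact (suppProj_coe A (sqrtTo A (D x))).symm

theorem exists_isLift {A T : H →L[ℂ] H} (hT : T ∈ BAHalf A) : ∃ U, IsLift A T U :=
  ⟨_, isLift_of_isDiamond (diamond_spec A T hT)⟩

/-! ### The A-seminorm and the A-operator norm through A^{1/2} -/

theorem apply_eq_sqrtOp_sqrtOp {A : H →L[ℂ] H} (hA : A.IsPositive) (x : H) :
    A x = sqrtOp A (sqrtOp A x) :=
  (DFunLike.congr_fun (sqrtOp_comp_sqrtOp A hA) x).symm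

theorem apply_eq_iff_sqrtTo_eq {A : H →L[ℂ] H} (hA : A.IsPositive) {x y : H} :
    A x = A y ↔ sqrtTo A x = sqrtTo A y := by
  rw [apply_eq_sqrtOp_sqrtOp hA, apply_eq_sqrtOp_sqrtOp hA y]
  exact ⟨fun h => Subtype.ext (sqrtOp_inj A (sqrtOp_mem_supp A x) (sqrtOp_mem_supp A y) h),
    fun h => congrArg (sqrtOp A) (congrArg Subtype.val h)⟩

theorem aSeminorm_eq_norm_sqrtTo {A : H →L[ℂ] H} (hA : A.IsPositive) (x : H) :
    aSeminorm A x = ‖sqrtTo A x‖ := by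
  have h : ⟪A x, x⟫_ℂ = ⟪sqrtOp A x, sqrtOp A x⟫_ℂ := by
    rw [apply_eq_sqrtOp_sqrtOp hA, ← ContinuousLinearMap.adjoint_inner_right, adjoint_sqrtOp]
  rw [aSeminorm, h, inner_self_eq_norm_sq, Real.sqrt_sq (norm_nonneg _)]
  rfl

theorem closure_range_eq_supp {A : H →L[ℂ] H} (hA : A.IsPositive) :
    closure (Set.range A) = supp A := by
  have hker : (sqrtOp A).ker = A.ker := by
    ext x
    have h := apply_eq_iff_sqrtTo_eq hA (x := x) (y := 0)
    rw [map_zero, map_zero, ← Subtype.coe_inj] at h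
    exact h.symm
  rw [supp, hker, ContinuousLinearMap.orthogonal_ker, hA.isSelfAdjoint.adjoint_eq]
  rfl

theorem sqrtTo_ne_zero {A : H →L[ℂ] H} {x : H} (hx : x ∈ supp A) (h0 : x ≠ 0) :
    sqrtTo A x ≠ 0 := fun h =>
  h0 (sqrtOp_inj A hx (Submodule.zero_mem _) (by
    rw [map_zero]; exact congrArg Subtype.val h))

theorem nontrivial_supp {A : H →L[ℂ] H} (hA : A.IsPositive) (hA0 : A ≠ 0) :
    Nontrivial (supp A) := by
  obtain ⟨x, hx⟩ := DFunLike.ne_iff.1 hA0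
  refine ⟨⟨sqrtTo A x, 0, fun h => hx ?_⟩⟩
  rw [zero_apply, ← map_zero A, apply_eq_iff_sqrtTo_eq hA, h, map_zero]

/-- The quotients in the supremum are ‖U y‖ / ‖y‖ with y = A^{1/2} x, and such y are dense in the
support. -/
theorem IsLift.aOpNorm_eq {A X : H →L[ℂ] H} {U : supp A →L[ℂ] supp A} (hA : A.IsPositive)
    (hA0 : A ≠ 0) (h : IsLift A X U) : aOpNorm A X = ‖U‖ := by
  have hn := nontrivial_supp hA hA0
  rw [aOpNorm, closure_range_eq_supp hA]
  have hle : ∀ c ∈ {c : ℝ | ∃ x ∈ (supp A : Set H), x ≠ 0 ∧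
      c = aSeminorm A (X x) / aSeminorm A x}, c ≤ ‖U‖ := by
    rintro _ ⟨x, hx, h0, rfl⟩
    rw [aSeminorm_eq_norm_sqrtTo hA, aSeminorm_eq_norm_sqrtTo hA, h]
    exact U.ratio_le_opNorm _
  -- A nonzero vector makes the set of quotients nonempty, as `csSup_le` requires, and later gives 0
  -- ≤ M.
  obtain ⟨x₀, hx₀⟩ := exists_ne (0 : supp A)
  have hx₀' : (x₀ : H) ≠ 0 := fun e => hx₀ (Subtype.ext e)
  refine le_antisymm (csSup_le ⟨_, x₀, x₀.2, hx₀', rfl⟩ hle) ?_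
  set M := sSup {c : ℝ | ∃ x ∈ (supp A : Set H), x ≠ 0 ∧
      c = aSeminorm A (X x) / aSeminorm A x} with hM
  have hratio : ∀ x ∈ supp A, x ≠ 0 → ‖U (sqrtTo A x)‖ / ‖sqrtTo A x‖ ≤ M := fun x hx h0 =>
    le_csSup ⟨‖U‖, hle⟩ ⟨x, hx, h0, by
      rw [aSeminorm_eq_norm_sqrtTo hA, aSeminorm_eq_norm_sqrtTo hA, h]⟩
  have hM0 : 0 ≤ M := (by positivity : (0 : ℝ) ≤ _).trans (hratio x₀ x₀.2 hx₀')
  refine U.opNorm_le_bound hM0 fun y => ?_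
  refine (denseRange_sqrtTo A).induction_on y
    (isClosed_le (by fun_prop) (by fun_prop)) fun x => ?_
  -- The supremum only sees vectors of the support, so x is replaced by its projection, which has
  -- the same image under A^{1/2}.
  rw [← sqrtTo_suppProj]
  by_cases h0 : suppProj A x = 0
  · simp [h0]
  · have h0' : (suppProj A x : H) ≠ 0 := fun e => h0 (Subtype.ext e)
    have hpos := norm_pos_iff.2 (sqrtTo_ne_zero (suppProj A x).2 h0')
    exact (div_le_iff₀ hpos).1 (hratio _ (suppProj A x).2 h0')

/-! ### A-invertibility and the A-spectrum -/

theorem comp_comp_eq_self_iff {A X Y : H →L[ℂ] H} (hA : A.IsPositive) :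
    A ∘L X ∘L Y = A ↔ ∀ x, sqrtTo A (X (Y x)) = sqrtTo A x := by
  simp_rw [← apply_eq_iff_sqrtTo_eq hA]
  exact ContinuousLinearMap.ext_iff

namespace IsLift

variable {A X Y : H →L[ℂ] H} {U V : supp A →L[ℂ] supp A}

theorem mul_eq_one (hX : IsLift A X U) (hY : IsLift A Y V)
    (h : ∀ x, sqrtTo A (X (Y x)) = sqrtTo A x) : U * V = 1 := by
  refine DFunLike.coe_injective ((denseRange_sqrtTo A).equalizer (U * V).continuous
    (1 : supp A →L[ℂ] supp A).continuous (funext fun x => ?_))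
  change U (V (sqrtTo A x)) = sqrtTo A x
  rw [← hY, ← hX, h]

theorem compress_mul_compress_eq_one (hX : IsLift A X U)
    (h : ∀ x, sqrtTo A (X (Y x)) = sqrtTo A x) : compress A X * compress A Y = 1 := by
  ext1 x
  change compress A X (suppProj A (Y x)) = x
  rw [← hX.suppProj_apply, suppProj_eq_of_sqrtOp_eq A (congrArg Subtype.val (h x)),
    suppProj_coe]

theorem isAInvertible_iff (hA : A.IsPositive) (hA0 : A ≠ 0) (hX : IsLift A X U) :
    IsAInvertible A X ↔ IsUnit U ∧ IsUnit (compress A X) := by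
  constructor
  · rintro ⟨-, -, Y, hY, -, h1, h2⟩
    rw [comp_comp_eq_self_iff hA] at h1 h2
    obtain ⟨V, hV⟩ := exists_isLift hY
    exact ⟨⟨⟨U, V, hX.mul_eq_one hV h1, hV.mul_eq_one hX h2⟩, rfl⟩,
      ⟨⟨_, _, hX.compress_mul_compress_eq_one h1, hV.compress_mul_compress_eq_one h2⟩, rfl⟩⟩
  · rintro ⟨⟨u, rfl⟩, ⟨w, hw⟩⟩
    -- The A-inverse is the inverse of the compression, extended by zero on ker A^{1/2}.
    let Y : H →L[ℂ] H := (supp A).subtypeL ∘L (↑w⁻¹ : supp A →L[ℂ] supp A) ∘L suppProj A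
    have hYx : ∀ x, Y x = ((↑w⁻¹ : supp A →L[ℂ] supp A) (suppProj A x) : supp A) := fun x => rfl
    have hXY : ∀ x, sqrtTo A (X (Y x)) = sqrtTo A x := fun x => by
      rw [hX, hYx, ← hX.sqrtTo_compress, ← hw, ← mul_apply_eq_comp, w.mul_inv,
        one_apply_eq_self, sqrtTo_suppProj]
    have hYX : ∀ x, sqrtTo A (Y (X x)) = sqrtTo A x := fun x => by
      rw [hYx, hX.suppProj_apply, ← hw, ← mul_apply_eq_comp, w.inv_mul,
        one_apply_eq_self, sqrtTo_suppProj]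
    -- Invertibility of the lift enters only here: it places Y in B_{A^{1/2}}(H).
    have hY : IsLift A Y (↑u⁻¹ : supp A →L[ℂ] supp A) := fun x => by
      rw [← hXY x, hX, ← mul_apply_eq_comp, u.inv_mul, one_apply_eq_self]
    rw [← comp_comp_eq_self_iff hA] at hXY hYX
    refine ⟨hX.mem_BAHalf, ?_, Y, hY.mem_BAHalf, ?_, hXY, hYX⟩
    · rintro rfl
      exact hA0 (by simpa using hXY.symm)
    · intro h0
      exact hA0 (by simpa [h0] using hXY.symm)

/-- The `A`-spectrum is the union of the spectra of the lift and of the compression. -/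
theorem aSpectrum_eq (hA : A.IsPositive) (hA0 : A ≠ 0) (hX : IsLift A X U) :
    aSpectrum A X = spectrum ℂ U ∪ spectrum ℂ (compress A X) := by
  ext z
  rw [aSpectrum, aResolventSet, Set.mem_compl_iff, Set.mem_ofPred_eq,
    (hX.smul_id_sub z).isAInvertible_iff hA hA0, compress_smul_id_sub, Set.mem_union,
    spectrum.mem_iff, spectrum.mem_iff, not_and_or]

theorem tendsto_aOpNorm_pow (hA : A.IsPositive) (hA0 : A ≠ 0) (hX : IsLift A X U) :
    Filter.Tendsto (fun n : ℕ => aOpNorm A (X ^ n) ^ (1 / (n : ℝ))) Filter.atTop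
      (𝓝 (spectralRadius ℂ U).toReal) := by
  have := nontrivial_supp hA hA0
  simp_rw [fun n : ℕ => (hX.pow n).aOpNorm_eq hA hA0]
  exact tendsto_norm_pow_toReal_spectralRadius U

theorem aSpectralRadius_eq (hA : A.IsPositive) (hA0 : A ≠ 0) (hX : IsLift A X U) :
    aSpectralRadius A X = (spectralRadius ℂ U).toReal :=
  (hX.tendsto_aOpNorm_pow hA hA0).limUnder_eq

end IsLift

/-- The `A`-spectral radii of `T` and of its reduced solution together bound the `A`-spectrum. -/
theorem isGreatest_norm_aSpectrum {A T D : H →L[ℂ] H} (hA : A.IsPositive) (hA0 : A ≠ 0)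
    (hD : IsDiamond A T D) :
    IsGreatest ((fun z : ℂ => ‖z‖) '' aSpectrum A T)
      (max (aSpectralRadius A T) (aSpectralRadius A D)) := by
  have := nontrivial_supp hA hA0
  -- Passing to the adjoint conjugates the spectrum and keeps moduli, so the compression of T can be
  -- traded for its adjoint, the lift of D.
  rw [(isLift_of_isDiamond hD).aSpectrum_eq hA hA0, Set.image_union,
    (isLift_of_isDiamond hD).aSpectralRadius_eq hA hA0,
    (isLift_diamond hD).aSpectralRadius_eq hA hA0, ← norm_image_spectrum_star (compress A T)]
  have h₁ := isGreatest_norm_spectrum (compress A (ContinuousLinearMap.adjoint D))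
  have h₂ := isGreatest_norm_spectrum (star (compress A T))
  exact h₁.union h₂

end SemiHilbert

theorem mainTheorem9 {H : Type*} [NormedAddCommGroup H] [InnerProductSpace ℂ H] [CompleteSpace H]
    (A : H →L[ℂ] H) (hA : A.IsPositive) (hA0 : A ≠ 0)
    (T : H →L[ℂ] H) (hT : T ∈ SemiHilbert.BAHalf A) :
    -- the limits defining `r_A(T)` and `r_A(T^◇)` exist
    Filter.Tendsto (fun n : ℕ => SemiHilbert.aOpNorm A (T ^ n) ^ (1 / (n : ℝ)))
        Filter.atTop (𝓝 (SemiHilbert.aSpectralRadius A T)) ∧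
    Filter.Tendsto
        (fun n : ℕ => SemiHilbert.aOpNorm A (SemiHilbert.diamond A T hT ^ n) ^ (1 / (n : ℝ)))
        Filter.atTop (𝓝 (SemiHilbert.aSpectralRadius A (SemiHilbert.diamond A T hT))) ∧
    -- `sup {|z| : z ∈ σ_A(T)}` is the larger of the two radii, hence one of them
    (SemiHilbert.aSpectralRadius A (SemiHilbert.diamond A T hT) ≤ SemiHilbert.aSpectralRadius A T →
      IsLUB ((fun z : ℂ => ‖z‖) '' SemiHilbert.aSpectrum A T)
        (SemiHilbert.aSpectralRadius A T)) ∧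
    (SemiHilbert.aSpectralRadius A T ≤ SemiHilbert.aSpectralRadius A (SemiHilbert.diamond A T hT) →
      IsLUB ((fun z : ℂ => ‖z‖) '' SemiHilbert.aSpectrum A T)
        (SemiHilbert.aSpectralRadius A (SemiHilbert.diamond A T hT))) ∧
    (IsLUB ((fun z : ℂ => ‖z‖) '' SemiHilbert.aSpectrum A T)
        (SemiHilbert.aSpectralRadius A T) ∨
      IsLUB ((fun z : ℂ => ‖z‖) '' SemiHilbert.aSpectrum A T)
        (SemiHilbert.aSpectralRadius A (SemiHilbert.diamond A T hT))) := by
  have hD := SemiHilbert.diamond_spec A T hT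
  have hT' := SemiHilbert.isLift_of_isDiamond hD
  have hD' := SemiHilbert.isLift_diamond hD
  have hg := (SemiHilbert.isGreatest_norm_aSpectrum hA hA0 hD).isLUB
  refine ⟨?_, ?_, fun h => ?_, fun h => ?_, ?_⟩
  · rw [hT'.aSpectralRadius_eq hA hA0]
    exact hT'.tendsto_aOpNorm_pow hA hA0
  · rw [hD'.aSpectralRadius_eq hA hA0]
    exact hD'.tendsto_aOpNorm_pow hA hA0
  · rwa [max_eq_left h] at hg
  · rwa [max_eq_right h] at hg
  · rcases le_total (SemiHilbert.aSpectralRadius A (SemiHilbert.diamond A T hT))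
      (SemiHilbert.aSpectralRadius A T) with h | h
    · rw [max_eq_left h] at hg
      exact Or.inl hg
    · rw [max_eq_right h] at hg
      exact Or.inr hg
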